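/- Consider channel access in a stationary Markov environment. There are a finite set $\mathcal S$ of states and a finite set of $K$ channels; for each state $j$ let $\mathcal T_j$ be the set of channels that are idle in state $j$, and let $A_{j,a}=I_{\{a\in\mathcal T_j\}}$. Let $\mathbf P=(P_{s,j})$ be an irreducible stochastic matrix on $\mathcal S$ with stationary distribution $\boldsymbol\pi=\boldsymbol\pi\mathbf P$, and let $C_a\in\mathbb R$ be the expected reward for accessing an idle channel $a$. For each $s$ let $m_s\in\arg\max_{j}P_{s,j}$ be a most likely next state, and assume $\mathcal T_{m_s}\neq\emptyset$. Maximum-likelihood (ML) prediction and access with decision rule $q$ works as follows: at time $t$, in state $s_t=s$ (with arbitrary initial state), a channel $a_t=a\in\mathcal T_{m_s}$ is accessed with probability $q_s(a)$; then, whatever the past and the channel accessed, the next state $s_{t+1}$ is $j$ with probability $P_{s,j}$; the reward $r_t$ is uniformly bounded, and given the past, $a_t=a$ and $s_{t+1}=j$ it has conditional expectation $A_{j,a}C_a$ (that is, $C_a$ if $a$ is idle in state $j$, and $0$ otherwise). The limiting throughput is the almost sure limit $\mathrm{Thr}=\lim_{T\to\infty}\frac1T\sum_{t=1}^T r_t$,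 and the ML throughput expression is $$ \Theta(q)=\sum_{s\in\mathcal S}\pi_s\Big(P_{s,m_s}\sum_{a\in\mathcal T_{m_s}}q_s(a)C_a+\sum_{j\neq m_s}P_{s,j}\sum_{a\in\mathcal T_j\cap\mathcal T_{m_s}}q_s(a)C_a\Big). $$ 1. If $q_s(a)=I_{\{a=a^*(s)\}}$ with $a^*(s)\in\arg\max_{a\in\mathcal T_{m_s}}C_a$ (any choice of maximizers), then $\Theta(q)$ equals the following expression, and the limiting throughput exists almost surely and has the same value: $$ \mathrm{Thr}=\sum_{s\in\mathcal S}\pi_s\,\max_{a\in\mathcal T_{m_s}}C_a\cdot\Big(P_{s,m_s}+\sum_{j\neq m_s}P_{s,j}A_{j,a^*(s)}\Big). $$ 2. If $C_a=C$ for all $a$ and $q_s(a)=\frac{1}{|\mathcal T_{m_s}|}I_{\{a\in\mathcal T_{m_s}\}}$, then $\Theta(q)$ equals each of the following expressions, and the limiting throughput exists almost surely and has the same value: $$ \mathrm{Thr}=C\sum_{s\in\mathcal S}\pi_s\Big(P_{s,m_s}+\sum_{j\neq m_s}P_{s,j}\frac{|\mathcal T_j\cap\mathcal T_{m_s}|}{|\mathcal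 T_{m_s}|}\Big) =C\sum_{s,j\in\mathcal S}\pi_sP_{s,j}\frac{|\mathcal T_j\cap\mathcal T_{m_s}|}{|\mathcal T_{m_s}|} =C\sum_{s,j\in\mathcal S}\pi_sP_{s,j}\frac{\sum_{a=1}^K A_{j,a}A_{m_s,a}}{\sum_{a=1}^K A_{m_s,a}}. $$ -/

import Mathlib

open MeasureTheory ProbabilityTheory Filter Topology
open scoped Matrix

/-- Entry `(j, a)` of the 0-1 connectivity matrix: it is `1` when channel `a` is idle in state `j`
(that is, `a ∈ idle j`) and `0` otherwise. -/
def connectivity {S Ch : Type*} [DecidableEq Ch] (idle : S → Finset Ch) (j : S) (a : Ch) : ℝ :=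
  if a ∈ idle j then 1 else 0

/-- `π` is a stationary distribution of the transition matrix `P`: a probability vector with
`π = π P`. -/
def IsStationaryDistribution {S : Type*} [Fintype S] (P : Matrix S S ℝ) (π : S → ℝ) : Prop :=
  π ∈ stdSimplex ℝ S ∧ π ᵥ* P = π

/-- `m` predicts a most likely next state: `m s ∈ argmax_j P s j` (ties broken arbitrarily). -/
def IsMLPrediction {S : Type*} (P : Matrix S S ℝ) (m : S → S) : Prop :=
  ∀ s j, P s j ≤ P s (m s)

/-- `best s ∈ argmax_{a ∈ idle (m s)} C a` (ties broken arbitrarily): a channel of highest expected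
reward among those that are idle in the predicted state. -/
def IsBestPredictedChannel {S Ch : Type*} (m : S → S) (idle : S → Finset Ch) (C : Ch → ℝ)
    (best : S → Ch) : Prop :=
  ∀ s, best s ∈ idle (m s) ∧ ∀ a ∈ idle (m s), C a ≤ C (best s)

/-- The decision rule that accesses channel `best s` in state `s`. -/
def deterministicRule {S Ch : Type*} [DecidableEq Ch] (best : S → Ch) (s : S) (a : Ch) : ℝ :=
  if a = best s then 1 else 0

/-- The decision rule that, in state `s`, accesses a uniformly chosen channel among those that are
idle in the predicted state `m s`. -/
noncomputable def uniformRule {S Ch : Type*} [DecidableEq Ch] (m : S → S) (idle : S → Finset Ch)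
    (s : S) (a : Ch) : ℝ :=
  1 / ((idle (m s)).card : ℝ) * (if a ∈ idle (m s) then 1 else 0)

/-- The throughput expression of maximum-likelihood prediction and access, where in state `s`
channel `a ∈ idle (m s)` is accessed with probability `q s a`. -/
noncomputable def mlThroughput {S Ch : Type*} [Fintype S] [DecidableEq S] [DecidableEq Ch]
    (P : Matrix S S ℝ) (π : S → ℝ) (m : S → S) (idle : S → Finset Ch) (C : Ch → ℝ)
    (q : S → Ch → ℝ) : ℝ :=
  ∑ s, π s * (P s (m s) * ∑ a ∈ idle (m s), q s a * C a
    + ∑ j ∈ Finset.univ.erase (m s), P s j * ∑ a ∈ idle j ∩ idle (m s), q s a * C a)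

/-- Channel access in a stationary (non-reactive) Markov environment. At time `t` the environment
is in state `st t`, the user accesses channel `act t`, the environment moves to `st (t + 1)` and the
user collects the reward `r t`; `hist t` is the information available when `act t` is chosen.
The initial state is arbitrary. -/
structure IsAccessProcess {S Ch Ω : Type*} [MeasurableSpace S] [MeasurableSpace Ch]
    {mΩ : MeasurableSpace Ω} (μ : Measure Ω) (P : Matrix S S ℝ) (idle : S → Finset Ch)
    (C : Ch → ℝ) (q : S → Ch → ℝ) [DecidableEq Ch] (hist : Filtration ℕ mΩ)
    (st : ℕ → Ω → S) (act : ℕ → Ω → Ch) (r : ℕ → Ω → ℝ) : Prop where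
  measurable_st : ∀ t, Measurable[hist t] (st t)
  measurable_act : ∀ t, Measurable[hist (t + 1)] (act t)
  measurable_r : ∀ t, Measurable[hist (t + 1)] (r t)
  /-- In state `s`, channel `a` is chosen with probability `q s a`. -/
  policy : ∀ t a, μ⟦{ω | act t ω = a} | hist t⟧ =ᵐ[μ] fun ω => q (st t ω) a
  /-- The next state is drawn from the row of `P` given by the current state, whatever the action. -/
  transition : ∀ t j,
    μ⟦{ω | st (t + 1) ω = j} | hist t ⊔ MeasurableSpace.comap (act t) inferInstance⟧
      =ᵐ[μ] fun ω => P (st t ω) j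
  /-- Given the past, the action `a` and the next state `j`, the expected reward is `C a` if `a` is
  idle in state `j`, and `0` otherwise. -/
  reward : ∀ t,
    μ[r t | hist t ⊔ MeasurableSpace.comap (act t) inferInstance
        ⊔ MeasurableSpace.comap (st (t + 1)) inferInstance]
      =ᵐ[μ] fun ω => connectivity idle (st (t + 1) ω) (act t ω) * C (act t ω)
  /-- The numbers of bits delivered in one slot are uniformly bounded. -/
  bounded : ∃ B : ℝ, ∀ t, ∀ᵐ ω ∂μ, |r t ω| ≤ B

/-- The limiting throughput equals `v` almost surely. -/
def HasLimitingThroughput {Ω : Type*} {mΩ : MeasurableSpace Ω} (μ : Measure Ω) (r : ℕ → Ω → ℝ)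
    (v : ℝ) : Prop :=
  ∀ᵐ ω ∂μ, Tendsto (fun n : ℕ => 1 / (n : ℝ) * ∑ t ∈ Finset.Icc 1 n, r t ω) atTop (𝓝 v)

/-! The reward collected in a slot is split into its conditional mean given the past and a bounded
martingale difference. The averages of the latter vanish: weighted by `1 / (t + 1)` they sum to an
`L²`-bounded martingale, which converges almost surely, and Kronecker's lemma applies. The
conditional mean is a function `f` of the current state; solving the Poisson equation
`g - P g = f - π ⬝ᵥ f` turns its average into `π ⬝ᵥ f` plus a telescoping sum and the average of
another bounded martingale difference. -/

section Averages

variable {E : Type*} [NormedAddCommGroup E] [NormedSpace ℝ E]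

/- Kronecker's lemma. The weights are `b (k + 1)` rather than `b k` so that `b n = n` gives averages
over `Finset.range n` without a vanishing weight. -/
theorem tendsto_inv_smul_sum_smul_of_tendsto_sum {b : ℕ → ℝ} (hb : Monotone b)
    (hb_top : Tendsto b atTop atTop) {d : ℕ → E} {l : E}
    (hd : Tendsto (fun n => ∑ k ∈ Finset.range n, d k) atTop (𝓝 l)) :
    Tendsto (fun n => (b n)⁻¹ • ∑ k ∈ Finset.range n, b (k + 1) • d k) atTop (𝓝 0) := by
  set M : ℕ → E := fun n => (∑ k ∈ Finset.range n, d k) - l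
  have hM : M =o[atTop] fun _ => (1 : ℝ) := by
    simpa only [Asymptotics.isLittleO_one_iff, sub_self] using hd.sub_const l
  have summation_by_parts (n : ℕ) : ∑ k ∈ Finset.range n, b (k + 1) • d k =
      b n • M n + b 0 • l - ∑ k ∈ Finset.range n, (b (k + 1) - b k) • M k := by
    induction n with
    | zero => simp [M]
    | succ n ih =>
      have hstep : M (n + 1) = M n + d n := by
        simp only [M, Finset.sum_range_succ]
        abel
      rw [Finset.sum_range_succ, Finset.sum_range_succ, ih, hstep]
      module
  have hconst : ∀ x : E, (fun _ : ℕ => x) =o[atTop] b := fun x =>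
    Asymptotics.isLittleO_const_left.2 (.inr (tendsto_norm_atTop_atTop.comp hb_top))
  have hincr : (fun n => ∑ k ∈ Finset.range n, (b (k + 1) - b k)) =O[atTop] b := by
    simp only [Finset.sum_range_sub]
    exact (Asymptotics.isBigO_refl b atTop).sub
      (Asymptotics.isLittleO_const_left.2 (.inr (tendsto_norm_atTop_atTop.comp hb_top))).isBigO
  have hsum : (fun n => ∑ k ∈ Finset.range n, (b (k + 1) - b k) • M k) =o[atTop] b := by
    refine .trans_isBigO (.sum_range ?_ (fun k => sub_nonneg.2 (hb k.le_succ)) ?_) hincr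
    · simpa using (Asymptotics.isBigO_refl (fun k => b (k + 1) - b k) atTop).smul_isLittleO hM
    · simp only [Finset.sum_range_sub]
      exact tendsto_atTop_add_const_right atTop (-b 0) hb_top
  have hfst : (fun n => b n • M n) =o[atTop] b := by
    simpa using (Asymptotics.isBigO_refl b atTop).smul_isLittleO hM
  have htotal := (hfst.add (hconst (b 0 • l))).sub hsum
  simp only [← summation_by_parts] at htotal
  exact htotal.tendsto_inv_smul_nhds_zero

theorem tendsto_average_Icc_of_tendsto_average_range {u : ℕ → E} {l : E}
    (hu : Tendsto (fun n : ℕ => (n : ℝ)⁻¹ • ∑ t ∈ Finset.range n, u t) atTop (𝓝 l)) :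
    Tendsto (fun n : ℕ => (n : ℝ)⁻¹ • ∑ t ∈ Finset.Icc 1 n, u t) atTop (𝓝 l) := by
  have hinv : Tendsto (fun n : ℕ => (n : ℝ)⁻¹) atTop (𝓝 0) := tendsto_inv_atTop_nhds_zero_nat
  have hlim := ((hinv.const_add 1).smul (hu.comp (tendsto_add_atTop_nat 1))).sub
    (hinv.smul_const (u 0))
  rw [add_zero, one_smul, zero_smul, sub_zero] at hlim
  refine hlim.congr' ?_
  filter_upwards [eventually_ge_atTop 1] with n hn
  have hn0 : (n : ℝ) ≠ 0 := by positivity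
  have hn1 : ((n + 1 : ℕ) : ℝ) ≠ 0 := by positivity
  have hratio : (1 + (n : ℝ)⁻¹) * ((n + 1 : ℕ) : ℝ)⁻¹ = (n : ℝ)⁻¹ := by
    field_simp
    push_cast
    ring
  rw [Function.comp_apply, smul_smul, hratio, ← smul_sub, Finset.range_eq_Ico,
    Finset.sum_eq_sum_Ico_succ_bot n.succ_pos, add_sub_cancel_left]
  rfl

end Averages

section MartingaleDifferences

variable {Ω : Type*} {m mΩ : MeasurableSpace Ω} {μ : Measure Ω} [IsFiniteMeasure μ]

theorem integral_mul_eq_zero_of_condExp_eq_zero {f g : Ω → ℝ} (hm : m ≤ mΩ)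
    (hf : StronglyMeasurable[m] f) (hfg : Integrable (f * g) μ) (hg : Integrable g μ)
    (hzero : μ[g | m] =ᵐ[μ] 0) : ∫ ω, f ω * g ω ∂μ = 0 := by
  have hcond : μ[f * g | m] =ᵐ[μ] 0 := by
    filter_upwards [condExp_mul_of_stronglyMeasurable_left hf hfg hg, hzero] with ω hpull hω
    rw [hpull, Pi.mul_apply, hω, Pi.zero_apply, mul_zero]
  calc ∫ ω, f ω * g ω ∂μ = ∫ ω, (μ[f * g | m]) ω ∂μ := (integral_condExp hm).symm
    _ = 0 := integral_eq_zero_of_ae hcond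

variable {ℱ : Filtration ℕ mΩ}

theorem stronglyAdapted_sum_range {E : Type*} [AddCommMonoid E] [TopologicalSpace E]
    [ContinuousAdd E] {D : ℕ → Ω → E} (hD : ∀ t, StronglyMeasurable[ℱ (t + 1)] (D t)) :
    StronglyAdapted ℱ fun n => ∑ t ∈ Finset.range n, D t := fun _ =>
  Finset.stronglyMeasurable_sum _ fun t ht => (hD t).mono (ℱ.mono (Finset.mem_range.1 ht))

theorem martingale_sum_range {E : Type*} [NormedAddCommGroup E] [NormedSpace ℝ E]
    [CompleteSpace E] {D : ℕ → Ω → E} (hD : ∀ t, StronglyMeasurable[ℱ (t + 1)] (D t))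
    (hint : ∀ t, Integrable (D t) μ) (hzero : ∀ t, μ[D t | ℱ t] =ᵐ[μ] 0) :
    Martingale (fun n => ∑ t ∈ Finset.range n, D t) ℱ μ := by
  refine martingale_of_condExp_sub_eq_zero_nat (stronglyAdapted_sum_range hD)
    (fun n => integrable_finsetSum' _ fun t _ => hint t) fun n => ?_
  rw [Finset.sum_range_succ_sub_sum]
  exact hzero n

variable {D : ℕ → Ω → ℝ}

theorem integral_sum_range_sq (hD : ∀ t, StronglyMeasurable[ℱ (t + 1)] (D t))
    (hL2 : ∀ t, MemLp (D t) 2 μ) (hzero : ∀ t, μ[D t | ℱ t] =ᵐ[μ] 0) (n : ℕ) :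
    ∫ ω, (∑ t ∈ Finset.range n, D t ω) ^ 2 ∂μ = ∑ t ∈ Finset.range n, ∫ ω, D t ω ^ 2 ∂μ := by
  induction n with
  | zero => simp
  | succ n ih =>
    set M : Ω → ℝ := fun ω => ∑ t ∈ Finset.range n, D t ω
    have hM : MemLp M 2 μ := memLp_finsetSum _ fun t _ => hL2 t
    have hMm : StronglyMeasurable[ℱ n] M := by
      simpa only [M, Finset.sum_fn] using stronglyAdapted_sum_range hD n
    have hMD : Integrable (fun ω => M ω * D n ω) μ := hM.integrable_mul (hL2 n)
    have hcross : ∫ ω, M ω * D n ω ∂μ = 0 := integral_mul_eq_zero_of_condExp_eq_zero (ℱ.le n)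
      hMm hMD ((hL2 n).integrable one_le_two) (hzero n)
    calc ∫ ω, (∑ t ∈ Finset.range (n + 1), D t ω) ^ 2 ∂μ
        = ∫ ω, (M ω ^ 2 + D n ω ^ 2 + 2 * (M ω * D n ω)) ∂μ := by
          refine integral_congr_ae (ae_of_all _ fun ω => ?_)
          simp only [M, Finset.sum_range_succ]
          ring
      _ = ∫ ω, M ω ^ 2 ∂μ + ∫ ω, D n ω ^ 2 ∂μ := by
          have hsq : Integrable (fun ω => M ω ^ 2 + D n ω ^ 2) μ :=
            hM.integrable_sq.add (hL2 n).integrable_sq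
          rw [integral_add hsq (hMD.const_mul 2), integral_add hM.integrable_sq
            (hL2 n).integrable_sq, integral_const_mul, hcross, mul_zero, add_zero]
      _ = ∑ t ∈ Finset.range (n + 1), ∫ ω, D t ω ^ 2 ∂μ := by
          rw [Finset.sum_range_succ, ih]

theorem eLpNorm_one_le_of_integral_sq_le {f : Ω → ℝ} (hf : MemLp f 2 μ) {K : ℝ}
    (hK : ∫ ω, f ω ^ 2 ∂μ ≤ K) : eLpNorm f 1 μ ≤ ENNReal.ofReal (μ.real Set.univ + K) := by
  rw [eLpNorm_one_eq_lintegral_enorm,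
    ← ofReal_integral_norm_eq_lintegral_enorm (hf.integrable one_le_two)]
  refine ENNReal.ofReal_le_ofReal ?_
  calc ∫ ω, ‖f ω‖ ∂μ ≤ ∫ ω, (1 + f ω ^ 2) ∂μ := by
        refine integral_mono (hf.integrable one_le_two).norm
          ((integrable_const _).add hf.integrable_sq) fun ω => ?_
        rw [Real.norm_eq_abs]
        nlinarith [sq_nonneg (|f ω| - 1), sq_abs (f ω), abs_nonneg (f ω)]
    _ = μ.real Set.univ + ∫ ω, f ω ^ 2 ∂μ := by
        rw [integral_add (integrable_const _) hf.integrable_sq, integral_const, smul_eq_mul,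
          mul_one]
    _ ≤ μ.real Set.univ + K := by gcongr

theorem ae_exists_tendsto_sum_of_condExp_eq_zero
    (hD : ∀ t, StronglyMeasurable[ℱ (t + 1)] (D t)) (hL2 : ∀ t, MemLp (D t) 2 μ)
    (hzero : ∀ t, μ[D t | ℱ t] =ᵐ[μ] 0) (hsum : Summable fun t => ∫ ω, D t ω ^ 2 ∂μ) :
    ∀ᵐ ω ∂μ, ∃ l, Tendsto (fun n => ∑ t ∈ Finset.range n, D t ω) atTop (𝓝 l) := by
  have hmart := martingale_sum_range hD (fun t => (hL2 t).integrable one_le_two) hzero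
  have hbound (n : ℕ) : eLpNorm (∑ t ∈ Finset.range n, D t) 1 μ ≤
      (μ.real Set.univ + ∑' t, ∫ ω, D t ω ^ 2 ∂μ).toNNReal := by
    refine eLpNorm_one_le_of_integral_sq_le (memLp_finsetSum' _ fun t _ => hL2 t) ?_
    simp only [Finset.sum_apply]
    rw [integral_sum_range_sq hD hL2 hzero]
    exact hsum.sum_le_tsum _ fun t _ => integral_nonneg fun ω => sq_nonneg _
  simpa only [Finset.sum_apply] using hmart.submartingale.exists_ae_tendsto_of_bdd hbound

theorem ae_tendsto_inv_mul_sum_of_condExp_eq_zero {b : ℕ → ℝ} (hb : Monotone b)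
    (hb_top : Tendsto b atTop atTop) (hb_ne : ∀ t, b (t + 1) ≠ 0)
    (hD : ∀ t, StronglyMeasurable[ℱ (t + 1)] (D t)) (hL2 : ∀ t, MemLp (D t) 2 μ)
    (hzero : ∀ t, μ[D t | ℱ t] =ᵐ[μ] 0)
    (hsum : Summable fun t => (∫ ω, D t ω ^ 2 ∂μ) / b (t + 1) ^ 2) :
    ∀ᵐ ω ∂μ, Tendsto (fun n => (b n)⁻¹ * ∑ t ∈ Finset.range n, D t ω) atTop (𝓝 0) := by
  have hzero' (t : ℕ) : μ[(b (t + 1))⁻¹ • D t | ℱ t] =ᵐ[μ] 0 := by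
    filter_upwards [condExp_smul (μ := μ) (b (t + 1))⁻¹ (D t) (ℱ t), hzero t] with ω hsmul hω
    rw [hsmul, Pi.smul_apply, hω, Pi.zero_apply, smul_zero]
  have hsum' : Summable fun t => ∫ ω, ((b (t + 1))⁻¹ • D t) ω ^ 2 ∂μ := by
    refine hsum.congr fun t => ?_
    simp only [Pi.smul_apply, smul_eq_mul, mul_pow, integral_const_mul, inv_pow]
    rw [div_eq_inv_mul]
  filter_upwards [ae_exists_tendsto_sum_of_condExp_eq_zero
    (fun t => (hD t).const_smul (b (t + 1))⁻¹) (fun t => (hL2 t).const_smul (b (t + 1))⁻¹)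
    hzero' hsum'] with ω ⟨l, hl⟩
  simpa only [Pi.smul_apply, smul_eq_mul, mul_inv_cancel_left₀ (hb_ne _)] using
    tendsto_inv_smul_sum_smul_of_tendsto_sum hb hb_top hl

theorem ae_tendsto_average_of_condExp_eq_zero {B : ℝ}
    (hD : ∀ t, StronglyMeasurable[ℱ (t + 1)] (D t)) (hB : ∀ t, ∀ᵐ ω ∂μ, |D t ω| ≤ B)
    (hzero : ∀ t, μ[D t | ℱ t] =ᵐ[μ] 0) :
    ∀ᵐ ω ∂μ, Tendsto (fun n : ℕ => (n : ℝ)⁻¹ * ∑ t ∈ Finset.range n, D t ω) atTop (𝓝 0) := by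
  have hL2 (t : ℕ) : MemLp (D t) 2 μ :=
    .of_bound ((hD t).mono (ℱ.le _)).aestronglyMeasurable B (hB t)
  have hsq (t : ℕ) : ∫ ω, D t ω ^ 2 ∂μ ≤ μ.real Set.univ * B ^ 2 := by
    calc ∫ ω, D t ω ^ 2 ∂μ ≤ ∫ _, B ^ 2 ∂μ :=
          integral_mono_ae (hL2 t).integrable_sq (integrable_const _)
            ((hB t).mono fun ω hω => sq_le_sq.2 (hω.trans (le_abs_self B)))
      _ = μ.real Set.univ * B ^ 2 := by rw [integral_const, smul_eq_mul]
  have hinv : Summable fun t : ℕ => ((t + 1 : ℕ) ^ 2 : ℝ)⁻¹ :=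
    (summable_nat_add_iff 1).2 (Real.summable_nat_pow_inv.2 one_lt_two)
  refine ae_tendsto_inv_mul_sum_of_condExp_eq_zero Nat.mono_cast tendsto_natCast_atTop_atTop
    (fun t => Nat.cast_ne_zero.2 t.succ_ne_zero) hD hL2 hzero ?_
  refine .of_nonneg_of_le (fun t => ?_) (fun t => ?_) (hinv.mul_left (μ.real Set.univ * B ^ 2))
  · exact div_nonneg (integral_nonneg fun ω => sq_nonneg _) (sq_nonneg _)
  · rw [div_eq_mul_inv]
    gcongr
    exact hsq t

theorem ae_tendsto_average_sub_condExp {Y : ℕ → Ω → ℝ} {B : ℝ}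
    (hY : ∀ t, StronglyMeasurable[ℱ (t + 1)] (Y t)) (hB : ∀ t, ∀ᵐ ω ∂μ, |Y t ω| ≤ B) :
    ∀ᵐ ω ∂μ, Tendsto (fun n : ℕ => (n : ℝ)⁻¹ * ∑ t ∈ Finset.range n, (Y t ω - (μ[Y t | ℱ t]) ω))
      atTop (𝓝 0) := by
  have hint (t : ℕ) : Integrable (Y t) μ :=
    .of_bound ((hY t).mono (ℱ.le _)).aestronglyMeasurable B (hB t)
  refine ae_tendsto_average_of_condExp_eq_zero (ℱ := ℱ) (D := fun t => Y t - μ[Y t | ℱ t])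
    (B := B + B)
    (fun t => (hY t).sub (stronglyMeasurable_condExp.mono (ℱ.mono t.le_succ))) (fun t => ?_)
    fun t => ?_
  · filter_upwards [hB t, ae_bdd_abs_condExp_of_ae_bdd_abs (m := ℱ t) (hB t)] with ω hYω hcondω
    exact (abs_sub _ _).trans (add_le_add hYω hcondω)
  · filter_upwards [condExp_sub (hint t) integrable_condExp (ℱ t),
      ℱ.condExp_condExp (μ := μ) (Y t) le_rfl] with ω hsub hidem
    rw [hsub, Pi.sub_apply, hidem, sub_self, Pi.zero_apply]

end MartingaleDifferences

section PoissonEquation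

variable {S : Type*} [Fintype S]

/-- The functions that are harmonic for `P` are constant. For a stochastic matrix this says that
there is a single recurrent class, transient states being allowed. -/
def IsUnichain {R : Type*} [NonUnitalNonAssocSemiring R] (P : Matrix S S R) : Prop :=
  ∀ g : S → R, P *ᵥ g = g → ∀ i j, g i = g j

theorem exists_sub_mulVec_eq_sub_dotProduct {K : Type*} [Field K] {P : Matrix S S K}
    (hP : IsUnichain P) {π : S → K} (hstat : π ᵥ* P = π) (hone : π ⬝ᵥ 1 = 1) (f : S → K) :
    ∃ g : S → K, ∀ s, g s - (P *ᵥ g) s = f s - π ⬝ᵥ f := by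
  let N : (S → K) →ₗ[K] S → K :=
    .id - P.mulVecLin + (dotProductBilin K K π).smulRight 1
  have hN (g : S → K) : N g = g - P *ᵥ g + (π ⬝ᵥ g) • (1 : S → K) := rfl
  have hπN (g : S → K) : π ⬝ᵥ N g = π ⬝ᵥ g := by
    rw [hN, dotProduct_add, dotProduct_sub, Matrix.dotProduct_mulVec, hstat, sub_self, zero_add,
      dotProduct_smul, hone, smul_eq_mul, mul_one]
  have hinj : Function.Injective N := by
    refine (injective_iff_map_eq_zero N).2 fun g hg => ?_
    have hmean : π ⬝ᵥ g = 0 := by rw [← hπN, hg, dotProduct_zero]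
    have hharm : P *ᵥ g = g := by
      rw [hN, hmean, zero_smul, add_zero, sub_eq_zero] at hg
      exact hg.symm
    ext s
    have hconst : g = g s • (1 : S → K) := by
      ext j
      simpa using hP g hharm j s
    rw [hconst, dotProduct_smul, hone] at hmean
    simpa using hmean
  obtain ⟨g, hg⟩ := LinearMap.injective_iff_surjective.1 hinj f
  refine ⟨g, fun s => ?_⟩
  rw [← hg, hπN, hN]
  simp

variable [DecidableEq S] {R : Type*}

theorem pow_mulVec_eq_self [Semiring R] {P : Matrix S S R} {g : S → R} (hg : P *ᵥ g = g) (k : ℕ) :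
    (P ^ k) *ᵥ g = g := by
  induction k with
  | zero => rw [pow_zero, Matrix.one_mulVec]
  | succ k ih => rw [pow_succ, ← Matrix.mulVec_mulVec, hg, ih]

variable [Ring R] [LinearOrder R] [IsStrictOrderedRing R] {P : Matrix S S R}

theorem eq_of_mulVec_apply_eq_of_forall_le (hP : P ∈ Matrix.rowStochastic R S) {g : S → R} {s : S}
    (hmax : ∀ j, g j ≤ g s) (hmean : (P *ᵥ g) s = g s) {j : S} (hj : 0 < P s j) : g j = g s := by
  have hsum : ∑ i, P s i * (g s - g i) = 0 := by
    simp only [mul_sub, Finset.sum_sub_distrib, ← Finset.sum_mul,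
      Matrix.sum_row_of_mem_rowStochastic hP, one_mul]
    exact sub_eq_zero.2 hmean.symm
  have hterm := (Finset.sum_eq_zero_iff_of_nonneg fun i _ =>
    mul_nonneg (hP.1 s i) (sub_nonneg.2 (hmax i))).1 hsum j (Finset.mem_univ j)
  exact (sub_eq_zero.1 ((mul_eq_zero.1 hterm).resolve_left hj.ne')).symm

theorem isUnichain_of_isIrreducible (hP : P ∈ Matrix.rowStochastic R S)
    (hirr : P.IsIrreducible) : IsUnichain P := by
  intro g hg i j
  have : Nonempty S := ⟨i⟩
  obtain ⟨s, hs⟩ := Finite.exists_max g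
  have hconst (j : S) : g j = g s := by
    obtain ⟨k, -, hk⟩ := (Matrix.isIrreducible_iff_exists_pow_pos hirr.nonneg).1 hirr s j
    exact eq_of_mulVec_apply_eq_of_forall_le (pow_mem hP k) hs
      (congrFun (pow_mulVec_eq_self hg k) s) hk
  rw [hconst i, hconst j]

end PoissonEquation

section MarkovChain

variable {S Ω ι κ : Type*} {m mΩ : MeasurableSpace Ω} {μ : Measure Ω} [IsFiniteMeasure μ]

theorem integrable_comp_of_finite [Finite κ] [MeasurableSpace κ] [MeasurableSingletonClass κ]
    {Y : Ω → κ} (hY : Measurable Y) (φ : κ → ℝ) : Integrable (fun ω => φ (Y ω)) μ :=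
  Integrable.of_finite.comp_measurable hY

theorem stronglyMeasurable_comp_of_finite [Finite κ] [MeasurableSpace κ]
    [MeasurableSingletonClass κ] {Y : Ω → κ} (hY : Measurable Y) (φ : κ → ℝ) :
    StronglyMeasurable fun ω => φ (Y ω) :=
  ((measurable_of_finite φ).comp hY).stronglyMeasurable

/- Only the conditional law of `X` matters, since the functions `F j` are known given `m`. -/
theorem condExp_apply_of_condProb [Fintype ι] [MeasurableSpace ι] [MeasurableSingletonClass ι]
    {X : Ω → ι} (hX : Measurable X) {p : ι → Ω → ℝ}
    (hp : ∀ j, μ⟦{ω | X ω = j} | m⟧ =ᵐ[μ] p j) {F : ι → Ω → ℝ}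
    (hF : ∀ j, StronglyMeasurable[m] (F j)) (hint : ∀ j, Integrable (F j) μ) :
    μ[fun ω => F (X ω) ω | m] =ᵐ[μ] fun ω => ∑ j, p j ω * F j ω := by
  have hmeas (j : ι) : MeasurableSet {ω | X ω = j} := hX (measurableSet_singleton j)
  have hone (j : ι) : Integrable ({ω | X ω = j}.indicator fun _ => (1 : ℝ)) μ :=
    (integrable_const 1).indicator (hmeas j)
  have hprod (j : ι) : Integrable (({ω | X ω = j}.indicator fun _ => (1 : ℝ)) * F j) μ := by
    have heq : ({ω | X ω = j}.indicator fun _ => (1 : ℝ)) * F j =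
        {ω | X ω = j}.indicator (F j) := by
      ext ω
      by_cases h : X ω = j <;> simp [h]
    rw [heq]
    exact (hint j).indicator (hmeas j)
  have hdecomp : (fun ω => F (X ω) ω) =
      ∑ j, ({ω | X ω = j}.indicator fun _ => (1 : ℝ)) * F j := by
    classical
    ext ω
    simp [Finset.sum_apply, Set.indicator_apply]
  have hpull (j : ι) : μ[({ω | X ω = j}.indicator fun _ => (1 : ℝ)) * F j | m]
      =ᵐ[μ] fun ω => p j ω * F j ω := by
    filter_upwards [condExp_mul_of_stronglyMeasurable_right (hF j) (hprod j) (hone j), hp j]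
      with ω hmul hprob
    rw [hmul, Pi.mul_apply, hprob]
  rw [hdecomp]
  filter_upwards [condExp_finsetSum (fun j _ => hprod j) m, ae_all_iff.2 hpull] with ω hsum hω
  rw [hsum, Finset.sum_apply]
  exact Finset.sum_congr rfl fun j _ => hω j

variable [MeasurableSpace S]

/-- `X` is a Markov chain with transition matrix `P` relative to the filtration `ℱ`. The law of
`X 0` is arbitrary. -/
structure IsMarkovChain (μ : Measure Ω) (P : Matrix S S ℝ) (ℱ : Filtration ℕ mΩ)
    (X : ℕ → Ω → S) : Prop where
  measurable : ∀ t, Measurable[ℱ t] (X t)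
  transition : ∀ t j, μ⟦{ω | X (t + 1) ω = j} | ℱ t⟧ =ᵐ[μ] fun ω => P (X t ω) j

namespace IsMarkovChain

variable [Fintype S] [MeasurableSingletonClass S] {P : Matrix S S ℝ} {ℱ : Filtration ℕ mΩ}
  {X : ℕ → Ω → S}

theorem condExp_comp_succ (h : IsMarkovChain μ P ℱ X) (g : S → ℝ) (t : ℕ) :
    μ[fun ω => g (X (t + 1) ω) | ℱ t] =ᵐ[μ] fun ω => (P *ᵥ g) (X t ω) :=
  condExp_apply_of_condProb ((h.measurable (t + 1)).mono (ℱ.le _) le_rfl) (h.transition t)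
    (F := fun j _ => g j) (fun _ => stronglyMeasurable_const) fun _ => integrable_const _

theorem ae_tendsto_average_comp (h : IsMarkovChain μ P ℱ X) (hP : IsUnichain P) {π : S → ℝ}
    (hπ : IsStationaryDistribution P π) (f : S → ℝ) :
    ∀ᵐ ω ∂μ, Tendsto (fun n : ℕ => (n : ℝ)⁻¹ * ∑ t ∈ Finset.range n, f (X t ω)) atTop
      (𝓝 (π ⬝ᵥ f)) := by
  have hone : π ⬝ᵥ (1 : S → ℝ) = 1 := by simpa [dotProduct] using hπ.1.2
  obtain ⟨g, hg⟩ := exists_sub_mulVec_eq_sub_dotProduct hP hπ.2 hone f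
  have hnoise := ae_tendsto_average_sub_condExp (μ := μ) (ℱ := ℱ) (Y := fun t ω => g (X (t + 1) ω))
    (fun t => stronglyMeasurable_comp_of_finite (h.measurable (t + 1)) g)
    (fun t => ae_of_all _ fun ω => norm_le_pi_norm g (X (t + 1) ω))
  filter_upwards [hnoise, ae_all_iff.2 (h.condExp_comp_succ g)] with ω hω hcond
  have hbdry : Tendsto (fun n : ℕ => (n : ℝ)⁻¹ * (g (X n ω) - g (X 0 ω))) atTop (𝓝 0) :=
    tendsto_inv_atTop_nhds_zero_nat.zero_mul_isBoundedUnder_le <| isBoundedUnder_of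
      ⟨‖g‖ + ‖g‖, fun n => (norm_sub_le _ _).trans
        (add_le_add (norm_le_pi_norm g _) (norm_le_pi_norm g _))⟩
  have htelescope (n : ℕ) : ∑ t ∈ Finset.range n, (g (X (t + 1) ω) - (P *ᵥ g) (X t ω)) =
      (g (X n ω) - g (X 0 ω)) + ∑ t ∈ Finset.range n, f (X t ω) - n * (π ⬝ᵥ f) := by
    have hstep (t : ℕ) : g (X (t + 1) ω) - (P *ᵥ g) (X t ω) =
        (g (X (t + 1) ω) - g (X t ω)) + f (X t ω) - π ⬝ᵥ f := by
      linarith [hg (X t ω)]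
    simp only [hstep, Finset.sum_sub_distrib, Finset.sum_add_distrib, Finset.sum_const,
      Finset.card_range, nsmul_eq_mul]
    rw [← Finset.sum_sub_distrib, Finset.sum_range_sub fun t => g (X t ω)]
  have hlim := (hω.sub hbdry).add_const (π ⬝ᵥ f)
  rw [sub_zero, zero_add] at hlim
  refine hlim.congr' ?_
  filter_upwards [eventually_ge_atTop 1] with n hn
  have hn0 : (n : ℝ) ≠ 0 := by positivity
  simp only [hcond]
  rw [htelescope]
  field_simp
  ring

end IsMarkovChain

end MarkovChain

section AccessProcess

/-- The expected reward of a slot that starts in state `s`, when channel `a` is accessed with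
probability `q s a` and the next state is drawn from the row `P s`. -/
def expectedReward {S Ch : Type*} [Fintype S] [Fintype Ch] [DecidableEq Ch] (P : Matrix S S ℝ)
    (idle : S → Finset Ch) (C : Ch → ℝ) (q : S → Ch → ℝ) (s : S) : ℝ :=
  ∑ a, q s a * ∑ j, P s j * (connectivity idle j a * C a)

namespace IsAccessProcess

variable {S Ch Ω : Type*} [MeasurableSpace S] [MeasurableSpace Ch] [DecidableEq Ch]
  {mΩ : MeasurableSpace Ω} {μ : Measure Ω} {P : Matrix S S ℝ} {idle : S → Finset Ch} {C : Ch → ℝ}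
  {q : S → Ch → ℝ} {hist : Filtration ℕ mΩ} {st : ℕ → Ω → S} {act : ℕ → Ω → Ch} {r : ℕ → Ω → ℝ}

theorem sup_comap_act_le (h : IsAccessProcess μ P idle C q hist st act r) (t : ℕ) :
    hist t ⊔ MeasurableSpace.comap (act t) inferInstance ≤ hist (t + 1) :=
  sup_le (hist.mono t.le_succ) (h.measurable_act t).comap_le

theorem sup_comap_st_le (h : IsAccessProcess μ P idle C q hist st act r) (t : ℕ) :
    hist t ⊔ MeasurableSpace.comap (act t) inferInstance
      ⊔ MeasurableSpace.comap (st (t + 1)) inferInstance ≤ hist (t + 1) :=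
  sup_le (h.sup_comap_act_le t) (h.measurable_st (t + 1)).comap_le

variable [MeasurableSingletonClass S] [IsFiniteMeasure μ]

theorem isMarkovChain [Finite S] (h : IsAccessProcess μ P idle C q hist st act r) :
    IsMarkovChain μ P hist st where
  measurable := h.measurable_st
  transition t j := by
    have hint : Integrable (fun ω => P (st t ω) j) μ :=
      integrable_comp_of_finite ((h.measurable_st t).mono (hist.le t) le_rfl) (P · j)
    have hmeas : StronglyMeasurable[hist t] fun ω => P (st t ω) j :=
      stronglyMeasurable_comp_of_finite (h.measurable_st t) (P · j)
    calc μ⟦{ω | st (t + 1) ω = j} | hist t⟧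
        =ᵐ[μ] μ[μ⟦{ω | st (t + 1) ω = j} |
            hist t ⊔ MeasurableSpace.comap (act t) inferInstance⟧ | hist t] :=
          (condExp_condExp_of_le le_sup_left ((h.sup_comap_act_le t).trans (hist.le _))).symm
      _ =ᵐ[μ] μ[fun ω => P (st t ω) j | hist t] := condExp_congr_ae (h.transition t j)
      _ = fun ω => P (st t ω) j := condExp_of_stronglyMeasurable (hist.le t) hmeas hint

variable [Fintype S] [MeasurableSingletonClass Ch]

theorem condExp_reward_sup_comap_act [Finite Ch]
    (h : IsAccessProcess μ P idle C q hist st act r) (t : ℕ) :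
    μ[r t | hist t ⊔ MeasurableSpace.comap (act t) inferInstance] =ᵐ[μ]
      fun ω => ∑ j, P (st t ω) j * (connectivity idle j (act t ω) * C (act t ω)) := by
  have hact : Measurable[hist t ⊔ MeasurableSpace.comap (act t) inferInstance] (act t) :=
    (comap_measurable (act t)).mono le_sup_right le_rfl
  calc μ[r t | hist t ⊔ MeasurableSpace.comap (act t) inferInstance]
      =ᵐ[μ] μ[μ[r t | hist t ⊔ MeasurableSpace.comap (act t) inferInstance
          ⊔ MeasurableSpace.comap (st (t + 1)) inferInstance] |
          hist t ⊔ MeasurableSpace.comap (act t) inferInstance] :=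
        (condExp_condExp_of_le le_sup_left ((h.sup_comap_st_le t).trans (hist.le _))).symm
    _ =ᵐ[μ] μ[fun ω => connectivity idle (st (t + 1) ω) (act t ω) * C (act t ω) |
          hist t ⊔ MeasurableSpace.comap (act t) inferInstance] := condExp_congr_ae (h.reward t)
    _ =ᵐ[μ] fun ω => ∑ j, P (st t ω) j * (connectivity idle j (act t ω) * C (act t ω)) :=
        condExp_apply_of_condProb (F := fun j ω => connectivity idle j (act t ω) * C (act t ω))
          ((h.measurable_st (t + 1)).mono (hist.le _) le_rfl) (h.transition t)
          (fun j => stronglyMeasurable_comp_of_finite hact fun a => connectivity idle j a * C a)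
          fun j => integrable_comp_of_finite ((h.measurable_act t).mono (hist.le _) le_rfl)
            fun a => connectivity idle j a * C a

variable [Fintype Ch]

theorem condExp_reward (h : IsAccessProcess μ P idle C q hist st act r) (t : ℕ) :
    μ[r t | hist t] =ᵐ[μ] fun ω => expectedReward P idle C q (st t ω) := by
  let meanReward (a : Ch) (s : S) : ℝ := ∑ j, P s j * (connectivity idle j a * C a)
  calc μ[r t | hist t]
      =ᵐ[μ] μ[μ[r t | hist t ⊔ MeasurableSpace.comap (act t) inferInstance] | hist t] :=
        (condExp_condExp_of_le le_sup_left ((h.sup_comap_act_le t).trans (hist.le _))).symm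
    _ =ᵐ[μ] μ[fun ω => meanReward (act t ω) (st t ω) | hist t] :=
        condExp_congr_ae (h.condExp_reward_sup_comap_act t)
    _ =ᵐ[μ] fun ω => ∑ a, q (st t ω) a * meanReward a (st t ω) :=
        condExp_apply_of_condProb (F := fun a ω => meanReward a (st t ω))
          ((h.measurable_act t).mono (hist.le _) le_rfl) (h.policy t)
          (fun a => stronglyMeasurable_comp_of_finite (h.measurable_st t) (meanReward a))
          fun a => integrable_comp_of_finite ((h.measurable_st t).mono (hist.le t) le_rfl)
            (meanReward a)

theorem hasLimitingThroughput (h : IsAccessProcess μ P idle C q hist st act r)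
    (hP : IsUnichain P) {π : S → ℝ} (hπ : IsStationaryDistribution P π) :
    HasLimitingThroughput μ r (π ⬝ᵥ expectedReward P idle C q) := by
  obtain ⟨B, hB⟩ := h.bounded
  filter_upwards [
    ae_tendsto_average_sub_condExp (fun t => (h.measurable_r t).stronglyMeasurable) hB,
    h.isMarkovChain.ae_tendsto_average_comp hP hπ (expectedReward P idle C q),
    ae_all_iff.2 h.condExp_reward] with ω hnoise hmean hcond
  simp only [one_div]
  refine tendsto_average_Icc_of_tendsto_average_range ?_
  simpa only [hcond, smul_eq_mul, Finset.sum_sub_distrib, mul_sub, sub_add_cancel, zero_add]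
    using hnoise.add hmean

end IsAccessProcess

end AccessProcess

section Throughput

section Connectivity

variable {S Ch : Type*} [Fintype Ch] [DecidableEq Ch] (idle : S → Finset Ch)

theorem sum_connectivity (j : S) : ∑ a, connectivity idle j a = (idle j).card := by
  simp [connectivity]

theorem sum_connectivity_mul_connectivity (i j : S) :
    ∑ a, connectivity idle i a * connectivity idle j a = (idle i ∩ idle j).card := by
  simp [connectivity, ← ite_and, ← Finset.mem_inter, Finset.inter_comm]

end Connectivity

section Rules

variable {S Ch : Type*} [DecidableEq Ch] {m : S → S} {idle : S → Finset Ch} {s : S} {a : Ch}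

theorem deterministicRule_of_notMem {C : Ch → ℝ} {best : S → Ch}
    (hbest : IsBestPredictedChannel m idle C best) (ha : a ∉ idle (m s)) :
    deterministicRule best s a = 0 :=
  if_neg fun hab : a = best s => ha (hab ▸ (hbest s).1)

theorem sum_deterministicRule_mul (best : S → Ch) (C : Ch → ℝ) (s : S) (A : Finset Ch) :
    ∑ a ∈ A, deterministicRule best s a * C a = if best s ∈ A then C (best s) else 0 := by
  simp [deterministicRule]

theorem uniformRule_of_notMem (ha : a ∉ idle (m s)) : uniformRule m idle s a = 0 := by
  rw [uniformRule, if_neg ha, mul_zero]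

theorem uniformRule_of_mem (ha : a ∈ idle (m s)) :
    uniformRule m idle s a = 1 / ((idle (m s)).card : ℝ) := by
  rw [uniformRule, if_pos ha, mul_one]

end Rules

variable {S Ch : Type*} [Fintype S] [DecidableEq S] [DecidableEq Ch] {P : Matrix S S ℝ}
  {m : S → S} {idle : S → Finset Ch} {C : Ch → ℝ}

theorem mlThroughput_eq_sum (π : S → ℝ) (q : S → Ch → ℝ) :
    mlThroughput P π m idle C q =
      ∑ s, π s * ∑ j, P s j * ∑ a ∈ idle j ∩ idle (m s), q s a * C a := by
  refine Finset.sum_congr rfl fun s _ => ?_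
  rw [← Finset.add_sum_erase Finset.univ _ (Finset.mem_univ (m s)), Finset.inter_self]

theorem mlThroughput_eq_dotProduct [Fintype Ch] (π : S → ℝ) {q : S → Ch → ℝ}
    (hq : ∀ s, ∀ a ∉ idle (m s), q s a = 0) :
    mlThroughput P π m idle C q = π ⬝ᵥ expectedReward P idle C q := by
  have hinter (s j : S) : ∑ a ∈ idle j ∩ idle (m s), q s a * C a =
      ∑ a, q s a * (connectivity idle j a * C a) := by
    rw [Finset.inter_comm, ← Finset.filter_mem_eq_inter, Finset.sum_filter,
      Finset.sum_subset (Finset.subset_univ _) fun a _ ha => by simp [hq s a ha]]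
    exact Finset.sum_congr rfl fun a _ => by simp [connectivity]
  rw [mlThroughput_eq_sum]
  refine Finset.sum_congr rfl fun s _ => congrArg (π s * ·) ?_
  simp only [hinter, expectedReward, Finset.mul_sum]
  rw [Finset.sum_comm]
  exact Finset.sum_congr rfl fun a _ => Finset.sum_congr rfl fun j _ => mul_left_comm _ _ _

theorem IsAccessProcess.hasLimitingThroughput_mlThroughput [Finite Ch] [MeasurableSpace S]
    [MeasurableSingletonClass S] [MeasurableSpace Ch] [MeasurableSingletonClass Ch] {Ω : Type*}
    {mΩ : MeasurableSpace Ω} {μ : Measure Ω} [IsFiniteMeasure μ] {q : S → Ch → ℝ}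
    {hist : Filtration ℕ mΩ} {st : ℕ → Ω → S} {act : ℕ → Ω → Ch} {r : ℕ → Ω → ℝ}
    (h : IsAccessProcess μ P idle C q hist st act r) (hP : IsUnichain P) {π : S → ℝ}
    (hπ : IsStationaryDistribution P π) (hq : ∀ s, ∀ a ∉ idle (m s), q s a = 0) :
    HasLimitingThroughput μ r (mlThroughput P π m idle C q) := by
  cases nonempty_fintype Ch
  rw [mlThroughput_eq_dotProduct π hq]
  exact h.hasLimitingThroughput hP hπ

theorem mlThroughput_deterministicRule (π : S → ℝ) (hidle : ∀ s, (idle (m s)).Nonempty)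
    {best : S → Ch} (hbest : IsBestPredictedChannel m idle C best) :
    mlThroughput P π m idle C (deterministicRule best) =
      ∑ s, π s * (idle (m s)).sup' (hidle s) C *
        (P s (m s) + ∑ j ∈ Finset.univ.erase (m s), P s j * connectivity idle j (best s)) := by
  refine Finset.sum_congr rfl fun s _ => ?_
  have hsup : (idle (m s)).sup' (hidle s) C = C (best s) :=
    le_antisymm (Finset.sup'_le _ _ (hbest s).2) (Finset.le_sup' C (hbest s).1)
  have hinter (j : S) : ∑ a ∈ idle j ∩ idle (m s), deterministicRule best s a * C a =
      connectivity idle j (best s) * C (best s) := by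
    simp [sum_deterministicRule_mul, connectivity, (hbest s).1]
  simp only [hsup, hinter, sum_deterministicRule_mul, if_pos (hbest s).1, ← mul_assoc,
    ← Finset.sum_mul]
  ring

theorem mlThroughput_uniformRule (π : S → ℝ) {c : ℝ} (hC : ∀ s, ∀ a ∈ idle (m s), C a = c) :
    mlThroughput P π m idle C (uniformRule m idle) =
      c * ∑ s, ∑ j, π s * P s j *
        (((idle j ∩ idle (m s)).card : ℝ) / ((idle (m s)).card : ℝ)) := by
  have hinter (s j : S) : ∑ a ∈ idle j ∩ idle (m s), uniformRule m idle s a * C a =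
      ((idle j ∩ idle (m s)).card : ℝ) / ((idle (m s)).card : ℝ) * c := by
    rw [Finset.sum_congr rfl fun a ha => by
      rw [uniformRule_of_mem (Finset.mem_inter.1 ha).2, hC s a (Finset.mem_inter.1 ha).2],
      Finset.sum_const, nsmul_eq_mul, ← mul_assoc, mul_one_div]
  rw [mlThroughput_eq_sum]
  simp only [hinter, Finset.mul_sum]
  exact Finset.sum_congr rfl fun s _ => Finset.sum_congr rfl fun j _ => by ring

theorem sum_predicted_add_sum_erase (π : S → ℝ) (hidle : ∀ s, (idle (m s)).Nonempty) :
    ∑ s, π s * (P s (m s) + ∑ j ∈ Finset.univ.erase (m s),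
        P s j * (((idle j ∩ idle (m s)).card : ℝ) / ((idle (m s)).card : ℝ))) =
      ∑ s, ∑ j, π s * P s j *
        (((idle j ∩ idle (m s)).card : ℝ) / ((idle (m s)).card : ℝ)) := by
  refine Finset.sum_congr rfl fun s _ => ?_
  have hcard : ((idle (m s)).card : ℝ) ≠ 0 := Nat.cast_ne_zero.2 (hidle s).card_ne_zero
  simp only [mul_assoc]
  rw [← Finset.mul_sum, ← Finset.add_sum_erase Finset.univ _ (Finset.mem_univ (m s)),
    Finset.inter_self, div_self hcard, mul_one]

end Throughput

theorem mainTheorem5_general {S Ch Ω : Type*}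
    [Fintype S] [DecidableEq S] [MeasurableSpace S] [MeasurableSingletonClass S]
    [Fintype Ch] [DecidableEq Ch] [MeasurableSpace Ch] [MeasurableSingletonClass Ch]
    {mΩ : MeasurableSpace Ω} (μ : Measure Ω) [IsFiniteMeasure μ]
    (P : Matrix S S ℝ) (hP : IsUnichain P)
    (π : S → ℝ) (hπ : IsStationaryDistribution P π)
    (idle : S → Finset Ch) (C : Ch → ℝ)
    (m : S → S) (hidle : ∀ s, (idle (m s)).Nonempty)
    (hist : Filtration ℕ mΩ) (st : ℕ → Ω → S) (act : ℕ → Ω → Ch) (r : ℕ → Ω → ℝ) :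
    (∀ best : S → Ch, IsBestPredictedChannel m idle C best →
      mlThroughput P π m idle C (deterministicRule best)
          = ∑ s, π s * (idle (m s)).sup' (hidle s) C *
              (P s (m s) + ∑ j ∈ Finset.univ.erase (m s),
                P s j * connectivity idle j (best s)) ∧
      (IsAccessProcess μ P idle C (deterministicRule best) hist st act r →
        HasLimitingThroughput μ r
          (∑ s, π s * (idle (m s)).sup' (hidle s) C *
              (P s (m s) + ∑ j ∈ Finset.univ.erase (m s),
                P s j * connectivity idle j (best s))))) ∧
    (∀ c : ℝ, (∀ s, ∀ a ∈ idle (m s), C a = c) →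
      mlThroughput P π m idle C (uniformRule m idle)
          = c * ∑ s, π s * (P s (m s) + ∑ j ∈ Finset.univ.erase (m s),
              P s j * (((idle j ∩ idle (m s)).card : ℝ) / ((idle (m s)).card : ℝ))) ∧
      mlThroughput P π m idle C (uniformRule m idle)
          = c * ∑ s, ∑ j, π s * P s j *
              (((idle j ∩ idle (m s)).card : ℝ) / ((idle (m s)).card : ℝ)) ∧
      mlThroughput P π m idle C (uniformRule m idle)
          = c * ∑ s, ∑ j, π s * P s j *
              ((∑ a, connectivity idle j a * connectivity idle (m s) a)
                / ∑ a, connectivity idle (m s) a) ∧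
      (IsAccessProcess μ P idle C (uniformRule m idle) hist st act r →
        HasLimitingThroughput μ r
          (c * ∑ s, ∑ j, π s * P s j *
              (((idle j ∩ idle (m s)).card : ℝ) / ((idle (m s)).card : ℝ))))) := by
  refine ⟨fun best hbest => ?_, fun c hC => ?_⟩
  · have hΘ := mlThroughput_deterministicRule (P := P) π hidle hbest
    refine ⟨hΘ, fun h => ?_⟩
    rw [← hΘ]
    exact h.hasLimitingThroughput_mlThroughput hP hπ fun s a => deterministicRule_of_notMem hbest
  · have hΘ : mlThroughput P π m idle C (uniformRule m idle) = c * ∑ s, ∑ j, π s * P s j *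
        (((idle j ∩ idle (m s)).card : ℝ) / ((idle (m s)).card : ℝ)) :=
      mlThroughput_uniformRule π hC
    refine ⟨?_, hΘ, ?_, fun h => ?_⟩
    · rw [sum_predicted_add_sum_erase π hidle, hΘ]
    · simp only [sum_connectivity, sum_connectivity_mul_connectivity, hΘ]
    · rw [← hΘ]
      exact h.hasLimitingThroughput_mlThroughput hP hπ fun s a => uniformRule_of_notMem

theorem mainTheorem5 {S Ch Ω : Type*}
    [Fintype S] [DecidableEq S] [MeasurableSpace S] [MeasurableSingletonClass S]
    [Fintype Ch] [DecidableEq Ch] [MeasurableSpace Ch] [MeasurableSingletonClass Ch]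
    {mΩ : MeasurableSpace Ω} (μ : Measure Ω) [IsProbabilityMeasure μ]
    (P : Matrix S S ℝ) (hP : P ∈ Matrix.rowStochastic ℝ S) (hirr : P.IsIrreducible)
    (π : S → ℝ) (hπ : IsStationaryDistribution P π)
    (idle : S → Finset Ch) (C : Ch → ℝ)
    (m : S → S) (hm : IsMLPrediction P m) (hidle : ∀ s, (idle (m s)).Nonempty)
    (hist : Filtration ℕ mΩ) (st : ℕ → Ω → S) (act : ℕ → Ω → Ch) (r : ℕ → Ω → ℝ) :
    -- deterministic access of a best channel among those idle in the predicted state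
    (∀ best : S → Ch, IsBestPredictedChannel m idle C best →
      mlThroughput P π m idle C (deterministicRule best)
          = ∑ s, π s * (idle (m s)).sup' (hidle s) C *
              (P s (m s) + ∑ j ∈ Finset.univ.erase (m s),
                P s j * connectivity idle j (best s)) ∧
      (IsAccessProcess μ P idle C (deterministicRule best) hist st act r →
        HasLimitingThroughput μ r
          (∑ s, π s * (idle (m s)).sup' (hidle s) C *
              (P s (m s) + ∑ j ∈ Finset.univ.erase (m s),
                P s j * connectivity idle j (best s))))) ∧
    -- equal rewards and uniform access of the channels idle in the predicted state
    (∀ c : ℝ, (∀ a, C a = c) →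
      mlThroughput P π m idle C (uniformRule m idle)
          = c * ∑ s, π s * (P s (m s) + ∑ j ∈ Finset.univ.erase (m s),
              P s j * (((idle j ∩ idle (m s)).card : ℝ) / ((idle (m s)).card : ℝ))) ∧
      mlThroughput P π m idle C (uniformRule m idle)
          = c * ∑ s, ∑ j, π s * P s j *
              (((idle j ∩ idle (m s)).card : ℝ) / ((idle (m s)).card : ℝ)) ∧
      mlThroughput P π m idle C (uniformRule m idle)
          = c * ∑ s, ∑ j, π s * P s j *
              ((∑ a, connectivity idle j a * connectivity idle (m s) a)
                / ∑ a, connectivity idle (m s) a) ∧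
      (IsAccessProcess μ P idle C (uniformRule m idle) hist st act r →
        HasLimitingThroughput μ r
          (c * ∑ s, ∑ j, π s * P s j *
              (((idle j ∩ idle (m s)).card : ℝ) / ((idle (m s)).card : ℝ))))) :=
  have h := mainTheorem5_general μ P (isUnichain_of_isIrreducible hP hirr) π hπ idle C m hidle
    hist st act r
  ⟨h.1, fun c hC => h.2 c fun _ a _ => hC a⟩
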